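/- Let $\Gamma$ be a totally ordered abelian group with positive cone $\Gamma^+=\{x\in\Gamma: x\ge 0\}$, let $s\in\Gamma^+$, and let $I$ be one of the intervals $[0,s]$, $[0,s)$ in $\Gamma^+$. For $t\in I$ let $1_t^I\in\ell^\infty(I)$ be the characteristic function of $I\cap[t,\infty)$, let $B_I=\overline{\operatorname{span}}\{1_t^I:t\in I\}\subset\ell^\infty(I)$, a unital $C^*$-algebra, and let $\tau^I$ be the action of $\Gamma^+$ on $B_I$ by the endomorphisms $\tau^I_r(f)(t)=f(t-r)$ if $t-r\in I$, and $0$ otherwise. A partial-isometric representation of $\Gamma^+$ in a $C^*$-algebra $D$ is a map $V:\Gamma^+\to D$ with $V_rV_r^*V_r=V_r$ and $V_rV_t=V_{r+t}$ for all $r,t\in\Gamma^+$. For an action $\alpha$ of $\Gamma^+$ by endomorphisms of a unital $C^*$-algebra $A$ with $\alpha_0=\mathrm{id}$, the partial-isometric crossed product $A\times_\alpha\Gamma^+$ is the Toeplitz algebra of the product system $X=\bigsqcup_{r\in\Gamma^+}X_r$ of Hilbert $A$-bimodules $X_r=\alpha_r(1)A$ with $x\cdot a=xa$, $a\cdot x=\alpha_r(a)x$,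 $\langle x,y\rangle=x^*y$ and multiplication $X_r\times X_t\to X_{r+t}$, $(x,y)\mapsto\alpha_t(x)y$; that is, it is the $C^*$-algebra generated by a universal Toeplitz representation $i_X$ of $X$. Put $i_{\Gamma^+}(r)=i_X(r,\alpha_r(1))^*$. Then $B_I\times_{\tau^I}\Gamma^+$, with $V=i_{\Gamma^+}$, is the universal $C^*$-algebra generated by a partial-isometric representation $V$ of $\Gamma^+$ such that $V_r=0$ for $r\notin I$. That is: $i_{\Gamma^+}$ is a partial-isometric representation of $\Gamma^+$ with $i_{\Gamma^+}(r)=0$ for $r\notin I$; the elements $i_{\Gamma^+}(r)$, $r\in\Gamma^+$, generate $B_I\times_{\tau^I}\Gamma^+$ as a $C^*$-algebra; and for every $C^*$-algebra $D$ and every partial-isometric representation $W$ of $\Gamma^+$ in $D$ with $W_r=0$ for $r\notin I$ there is a unique (not necessarily unital) $*$-homomorphism $\varphi:B_I\times_{\tau^I}\Gamma^+\to D$ with $\varphi(i_{\Gamma^+}(r))=W_r$ for all $r\in\Gamma^+$. -/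

import Mathlib

open scoped ENNReal

universe u w

noncomputable section

/-! ### The free unital `*`-algebra on a set -/

/-- The opposite of a complex algebra, with the conjugate scalar action. -/
def ConjOp (F : Type*) : Type _ := Fᵐᵒᵖ

instance (F : Type*) [Ring F] : Ring (ConjOp F) := inferInstanceAs (Ring Fᵐᵒᵖ)

instance (F : Type*) [Ring F] [Algebra ℂ F] : Algebra ℂ (ConjOp F) :=
  ((algebraMap ℂ Fᵐᵒᵖ).comp (starRingEnd ℂ)).toAlgebra' fun c x =>
    Algebra.commutes (R := ℂ) (A := Fᵐᵒᵖ) (starRingEnd ℂ c) x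

/-- The free unital complex `*`-algebra on a set `G`: noncommutative polynomials in the letters
`(g, false)`, standing for `g`, and `(g, true)`, standing for the adjoint of `g`. -/
def FreeStarAlgebra (G : Type*) : Type _ := FreeAlgebra ℂ (G × Bool)

namespace FreeStarAlgebra

variable {G : Type*}

instance : Ring (FreeStarAlgebra G) := inferInstanceAs (Ring (FreeAlgebra ℂ (G × Bool)))

instance : Algebra ℂ (FreeStarAlgebra G) :=
  inferInstanceAs (Algebra ℂ (FreeAlgebra ℂ (G × Bool)))

/-- The letters. -/
def letter (y : G × Bool) : FreeStarAlgebra G := FreeAlgebra.ι ℂ y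

/-- The generators. -/
def gen (g : G) : FreeStarAlgebra G := letter (g, false)

/-- The conjugate-linear anti-automorphism that exchanges `(g, false)` and `(g, true)`. -/
def starHom : FreeStarAlgebra G →ₐ[ℂ] ConjOp (FreeStarAlgebra G) :=
  FreeAlgebra.lift ℂ fun y : G × Bool =>
    (MulOpposite.op (letter (y.1, !y.2)) : (FreeStarAlgebra G)ᵐᵒᵖ)

def starFun (x : FreeStarAlgebra G) : FreeStarAlgebra G :=
  MulOpposite.unop (starHom x : (FreeStarAlgebra G)ᵐᵒᵖ)

theorem starFun_letter (y : G × Bool) : starFun (letter y) = letter (y.1, !y.2) := by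
  unfold starFun starHom letter
  erw [FreeAlgebra.lift_ι_apply]
  rfl

theorem starFun_algebraMap (c : ℂ) :
    starFun (algebraMap ℂ (FreeStarAlgebra G) c) = algebraMap ℂ _ (starRingEnd ℂ c) := by
  unfold starFun
  rw [AlgHom.commutes]
  rfl

theorem starFun_add (x y : FreeStarAlgebra G) : starFun (x + y) = starFun x + starFun y := by
  unfold starFun
  rw [map_add]
  rfl

theorem starFun_mul (x y : FreeStarAlgebra G) : starFun (x * y) = starFun y * starFun x := by
  unfold starFun
  rw [map_mul]
  rfl

theorem induction {P : FreeStarAlgebra G → Prop} (hc : ∀ c, P (algebraMap ℂ _ c))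
    (hl : ∀ y, P (letter y)) (hm : ∀ x y, P x → P y → P (x * y))
    (ha : ∀ x y, P x → P y → P (x + y)) (x : FreeStarAlgebra G) : P x :=
  FreeAlgebra.induction ℂ (G × Bool) hc hl hm ha x

instance : StarRing (FreeStarAlgebra G) where
  star := starFun
  star_involutive x := by
    refine induction (P := fun x => starFun (starFun x) = x) ?_ ?_ ?_ ?_ x
    · intro c; simp [starFun_algebraMap]
    · intro y; simp [starFun_letter]
    · intro x y hx hy; simp [starFun_mul, hx, hy]
    · intro x y hx hy; simp [starFun_add, hx, hy]
  star_mul := starFun_mul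
  star_add := starFun_add

theorem star_letter (y : G × Bool) : star (letter y) = letter (y.1, !y.2) := starFun_letter y

instance : StarModule ℂ (FreeStarAlgebra G) where
  star_smul c x := by
    change starFun (c • x) = star c • starFun x
    rw [Algebra.smul_def, starFun_mul, starFun_algebraMap, Algebra.smul_def, Algebra.commutes]
    rfl

end FreeStarAlgebra

/-! ### C⋆-seminorms on a `*`-algebra and their completions -/

/-- A C⋆-seminorm: a submultiplicative seminorm with `p (x⋆ x) = p x ^ 2`. -/
structure CStarSeminorm (F : Type*) [Ring F] [Algebra ℂ F] [StarRing F] extends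
    Seminorm ℂ F where
  mul_le' : ∀ x y, toFun (x * y) ≤ toFun x * toFun y
  star_mul_self' : ∀ x, toFun (star x * x) = toFun x ^ 2

namespace CStarSeminorm

variable {F : Type*} [Ring F] [Algebra ℂ F] [StarRing F]

instance : CoeFun (CStarSeminorm F) fun _ => F → ℝ := ⟨fun p => p.toSeminorm⟩

theorem nonneg (p : CStarSeminorm F) (x : F) : 0 ≤ p x := apply_nonneg p.toSeminorm x

theorem mul_le (p : CStarSeminorm F) (x y : F) : p (x * y) ≤ p x * p y := p.mul_le' x y

theorem star_mul_self (p : CStarSeminorm F) (x : F) : p (star x * x) = p x ^ 2 :=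
  p.star_mul_self' x

theorem le_star (p : CStarSeminorm F) (x : F) : p x ≤ p (star x) := by
  have h1 := p.star_mul_self x
  have h2 := p.mul_le (star x) x
  rcases (p.nonneg x).eq_or_lt with h | h
  · rw [← h]; exact p.nonneg _
  · rw [h1, sq] at h2
    exact le_of_mul_le_mul_right h2 h

theorem map_star (p : CStarSeminorm F) (x : F) : p (star x) = p x :=
  le_antisymm (by simpa using p.le_star (star x)) (p.le_star x)

theorem eq_of_sub (p : CStarSeminorm F) {x y : F} (h : p (x - y) = 0) : p x = p y := by
  have := abs_sub_map_le_sub p.toSeminorm x y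
  rw [h] at this
  exact sub_eq_zero.1 (abs_nonpos_iff.1 this)

/-- The `*`-algebra `F`, seminormed by `p`. -/
def Pre (_ : CStarSeminorm F) : Type _ := F

variable (p : CStarSeminorm F)

instance : SeminormedRing p.Pre :=
  { (p.toSeminorm.toAddGroupSeminorm.toSeminormedAddCommGroup : SeminormedAddCommGroup F),
    (inferInstance : Ring F) with
    norm_mul_le := p.mul_le }

instance : Algebra ℂ p.Pre := inferInstanceAs (Algebra ℂ F)
instance : StarRing p.Pre := inferInstanceAs (StarRing F)
instance [StarModule ℂ F] : StarModule ℂ p.Pre := inferInstanceAs (StarModule ℂ F)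

theorem norm_pre (x : p.Pre) : ‖x‖ = p.toSeminorm (x : F) := rfl

instance : NormedSpace ℂ p.Pre where
  norm_smul_le c x := (map_smul_eq_mul p.toSeminorm c (x : F)).le

/-- The Hausdorff completion of `F` in the C⋆-seminorm `p`. -/
def Compl : Type _ := UniformSpace.Completion p.Pre

instance : NormedRing p.Compl := inferInstanceAs (NormedRing (UniformSpace.Completion p.Pre))
instance : CompleteSpace p.Compl :=
  inferInstanceAs (CompleteSpace (UniformSpace.Completion p.Pre))
instance : NormedSpace ℂ p.Compl :=
  inferInstanceAs (NormedSpace ℂ (UniformSpace.Completion p.Pre))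

/-- The canonical map of `F` into its completion. -/
def toCompl (x : F) : p.Compl := UniformSpace.Completion.coe' (α := p.Pre) x

theorem norm_toCompl (x : F) : ‖p.toCompl x‖ = p x := UniformSpace.Completion.norm_coe (E := p.Pre) x

theorem toCompl_add (x y : F) : p.toCompl (x + y) = p.toCompl x + p.toCompl y :=
  UniformSpace.Completion.coe_add (α := p.Pre) x y

theorem toCompl_sub (x y : F) : p.toCompl (x - y) = p.toCompl x - p.toCompl y :=
  UniformSpace.Completion.coe_sub (α := p.Pre) x y

theorem toCompl_mul (x y : F) : p.toCompl (x * y) = p.toCompl x * p.toCompl y :=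
  UniformSpace.Completion.coe_mul (α := p.Pre) x y

theorem toCompl_smul (c : ℂ) (x : F) : p.toCompl (c • x) = c • p.toCompl x :=
  UniformSpace.Completion.coe_smul (X := p.Pre) c x

theorem denseRange_toCompl : DenseRange p.toCompl :=
  UniformSpace.Completion.denseRange_coe (α := p.Pre)

theorem continuous_const_smul_compl (c : ℂ) : Continuous fun x : p.Compl => c • x :=
  continuous_const_smul c

instance : Algebra ℂ p.Compl :=
  Algebra.ofModule
    (fun c x y => by
      have h := p.continuous_const_smul_compl c
      refine p.denseRange_toCompl.induction_on₂
        (p := fun x y : p.Compl => c • x * y = c • (x * y))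
        (isClosed_eq ((h.comp continuous_fst).mul continuous_snd) (h.comp continuous_mul))
        (fun a b => ?_) x y
      rw [← toCompl_smul, ← toCompl_mul, ← toCompl_mul, ← toCompl_smul, smul_mul_assoc])
    (fun c x y => by
      have h := p.continuous_const_smul_compl c
      refine p.denseRange_toCompl.induction_on₂
        (p := fun x y : p.Compl => x * c • y = c • (x * y))
        (isClosed_eq (continuous_fst.mul (h.comp continuous_snd)) (h.comp continuous_mul))
        (fun a b => ?_) x y
      rw [← toCompl_smul, ← toCompl_mul, ← toCompl_mul, ← toCompl_smul, mul_smul_comm])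

theorem isometry_star_pre : Isometry (star : p.Pre → p.Pre) :=
  AddMonoidHomClass.isometry_of_norm (starAddEquiv : p.Pre ≃+ p.Pre) fun x => p.map_star x

instance : Star p.Compl := ⟨UniformSpace.Completion.map (star : p.Pre → p.Pre)⟩

theorem continuous_star_compl : Continuous (star : p.Compl → p.Compl) :=
  UniformSpace.Completion.continuous_map

theorem toCompl_star (x : F) : p.toCompl (star x) = star (p.toCompl x) :=
  (UniformSpace.Completion.map_coe p.isometry_star_pre.uniformContinuous (x : p.Pre)).symm

instance : StarRing p.Compl where
  star_involutive x := by
    refine p.denseRange_toCompl.induction_on (p := fun x : p.Compl => star (star x) = x) x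
      (isClosed_eq (p.continuous_star_compl.comp p.continuous_star_compl) continuous_id)
      fun a => ?_
    rw [← toCompl_star, ← toCompl_star, star_star]
  star_mul x y := by
    have h := p.continuous_star_compl
    refine p.denseRange_toCompl.induction_on₂
      (p := fun x y : p.Compl => star (x * y) = star y * star x)
      (isClosed_eq (by fun_prop) (by fun_prop)) (fun a b => ?_) x y
    rw [← toCompl_mul, ← toCompl_star, ← toCompl_star, ← toCompl_star, star_mul, toCompl_mul]
  star_add x y := by
    have h := p.continuous_star_compl
    refine p.denseRange_toCompl.induction_on₂
      (p := fun x y : p.Compl => star (x + y) = star x + star y)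
      (isClosed_eq (by fun_prop) (by fun_prop)) (fun a b => ?_) x y
    rw [← toCompl_add, ← toCompl_star, ← toCompl_star, ← toCompl_star, star_add, toCompl_add]

/-- The Hausdorff completion in a C⋆-seminorm is a C⋆-algebra. -/
instance [StarModule ℂ F] : CStarAlgebra p.Compl where
  norm_smul_le := norm_smul_le
  norm_mul_self_le x := by
    have h := p.continuous_star_compl
    refine p.denseRange_toCompl.induction_on
      (p := fun x : p.Compl => ‖x‖ * ‖x‖ ≤ ‖star x * x‖) x
      (isClosed_le (by fun_prop) (by fun_prop)) fun a => ?_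
    rw [← toCompl_star, ← toCompl_mul, norm_toCompl, norm_toCompl, star_mul_self, sq]
  star_smul c x := by
    have h := p.continuous_star_compl
    refine p.denseRange_toCompl.induction_on
      (p := fun x : p.Compl => star (c • x) = star c • star x) x
      (isClosed_eq (h.comp (p.continuous_const_smul_compl c))
        ((p.continuous_const_smul_compl (star c)).comp h)) fun a => ?_
    rw [← toCompl_smul, ← toCompl_star, ← toCompl_star, star_smul, toCompl_smul]

/-- The zero seminorm. -/
def zero (F : Type*) [Ring F] [Algebra ℂ F] [StarRing F] : CStarSeminorm F where
  toSeminorm := 0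
  mul_le' x y := by change (0 : ℝ) ≤ 0 * 0; simp
  star_mul_self' x := by change (0 : ℝ) = 0 ^ 2; simp

/-- The pointwise supremum of a nonempty pointwise bounded set of C⋆-seminorms. -/
def sup (S : Set (CStarSeminorm F)) (hne : S.Nonempty)
    (hS : ∀ x : F, BddAbove (Set.range fun q : S => (q : CStarSeminorm F) x)) :
    CStarSeminorm F :=
  haveI : Nonempty S := hne.to_subtype
  { toFun := fun x => ⨆ q : S, (q : CStarSeminorm F) x
    map_zero' := by simp
    add_le' := fun x y => ciSup_le fun q => (map_add_le_add q.1.toSeminorm x y).trans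
      (add_le_add (le_ciSup (hS x) q) (le_ciSup (hS y) q))
    neg' := fun x => by simp
    smul' := fun c x => by
      simp only [map_smul_eq_mul]
      rw [Real.mul_iSup_of_nonneg (norm_nonneg c)]
    mul_le' := fun x y => ciSup_le fun q => (q.1.mul_le x y).trans
      (mul_le_mul (le_ciSup (hS x) q) (le_ciSup (hS y) q) (q.1.nonneg y)
        ((q.1.nonneg x).trans (le_ciSup (hS x) q)))
    star_mul_self' := fun x => by
      simp only [star_mul_self]
      have h0 : 0 ≤ ⨆ q : S, (q : CStarSeminorm F) x := Real.iSup_nonneg fun q => q.1.nonneg x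
      have hb : BddAbove (Set.range fun q : S => (q : CStarSeminorm F) x ^ 2) := by
        obtain ⟨M, hM⟩ := hS x
        refine ⟨M ^ 2, ?_⟩
        rintro _ ⟨q, rfl⟩
        exact pow_le_pow_left₀ (q.1.nonneg x) (hM ⟨q, rfl⟩) 2
      apply le_antisymm
      · exact ciSup_le fun q => pow_le_pow_left₀ (q.1.nonneg x) (le_ciSup (hS x) q) 2
      · rw [← Real.le_sqrt h0 (Real.iSup_nonneg fun q => sq_nonneg _)]
        exact ciSup_le fun q => Real.le_sqrt_of_sq_le (le_ciSup hb q) }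

end CStarSeminorm

/-! ### Dynamical systems and their product systems of Hilbert bimodules -/

/-- The positive cone `Γ⁺` of an ordered abelian group. -/
abbrev PosCone (Γ : Type*) [AddCommGroup Γ] [LinearOrder Γ] [IsOrderedAddMonoid Γ] : Type _ :=
  {x : Γ // 0 ≤ x}

/-- An action `α` of `Γ⁺` by (not necessarily unital) `*`-endomorphisms of a unital C⋆-algebra,
with `α_0 = id`.  As `A` is unital, every endomorphism of `A` is extendible and `M(A) = A`. -/
structure EndoAction (Γ : Type*) [AddCommGroup Γ] [LinearOrder Γ] [IsOrderedAddMonoid Γ]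
    (A : Type*) [CStarAlgebra A] where
  endo : PosCone Γ → (A →⋆ₙₐ[ℂ] A)
  endo_zero : ∀ a, endo 0 a = a
  endo_add : ∀ s t a, endo (s + t) a = endo s (endo t a)

namespace EndoAction

variable {Γ : Type*} [AddCommGroup Γ] [LinearOrder Γ] [IsOrderedAddMonoid Γ]
  {A : Type*} [CStarAlgebra A] (α : EndoAction Γ A)

/-- The fibre `X_s = α_s(1) A` of the product system. -/
def Fibre (s : PosCone Γ) : Submodule ℂ A := LinearMap.range (LinearMap.mulLeft ℂ (α.endo s 1))

variable {α} in
theorem mem_fibre {s : PosCone Γ} {x : A} : x ∈ α.Fibre s ↔ α.endo s 1 * x = x := by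
  constructor
  · rintro ⟨a, rfl⟩
    simp [← mul_assoc, ← map_mul]
  · intro h
    exact ⟨x, h⟩

/-- The right action `x · a = x a` on `X_s`. -/
def rightAct {s : PosCone Γ} (x : α.Fibre s) (a : A) : α.Fibre s :=
  ⟨x * a, mem_fibre.2 (by rw [← mul_assoc, mem_fibre.1 x.2])⟩

/-- The left action `a · x = α_s(a) x` on `X_s`. -/
def leftAct {s : PosCone Γ} (a : A) (x : α.Fibre s) : α.Fibre s :=
  ⟨α.endo s a * x, mem_fibre.2 (by rw [← mul_assoc, ← map_mul, one_mul])⟩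

/-- The `A`-valued inner product `⟨x, y⟩ = x⋆ y` on `X_s`. -/
def fibreInner {s : PosCone Γ} (x y : α.Fibre s) : A := star (x : A) * y

/-- The multiplication `X_s × X_t → X_{s+t}`, `(x, y) ↦ α_t(x) y`. -/
def fibreMul {s t : PosCone Γ} (x : α.Fibre s) (y : α.Fibre t) : α.Fibre (s + t) :=
  ⟨α.endo t x * y, mem_fibre.2 (by
    rw [add_comm s t, α.endo_add, ← mul_assoc, ← map_mul, mem_fibre.1 x.2])⟩

/-- The identification of `A` with `X_0`. -/
def toFibreZero (a : A) : α.Fibre 0 := ⟨a, mem_fibre.2 (by rw [α.endo_zero, one_mul])⟩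

/-- The element `α_s(1)` of `X_s`. -/
def fibreOne (s : PosCone Γ) : α.Fibre s := ⟨α.endo s 1, mem_fibre.2 (by rw [← map_mul, one_mul])⟩

/-! ### The Toeplitz algebra of the product system -/

/-- The free unital `*`-algebra on the disjoint union of the fibres. -/
abbrev Free : Type _ := FreeStarAlgebra (Σ s, α.Fibre s)

/-- The generator that belongs to `x ∈ X_s`. -/
def gen {s : PosCone Γ} (x : α.Fibre s) : α.Free := FreeStarAlgebra.gen ⟨s, x⟩

/-- The relations which say that `gen` is a Toeplitz representation of the product system:
it is linear on each fibre, a `*`-homomorphism on `X_0 = A`, compatible with the bimodule actions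
and the inner product of each fibre, and multiplicative.  The last relation says that
the unit of `A` is the unit of the algebra generated, which for a unital `A` is automatic. -/
inductive ToeplitzRel : α.Free → α.Free → Prop
  | add {s : PosCone Γ} (x y : α.Fibre s) : ToeplitzRel (α.gen (x + y)) (α.gen x + α.gen y)
  | smul {s : PosCone Γ} (c : ℂ) (x : α.Fibre s) : ToeplitzRel (α.gen (c • x)) (c • α.gen x)
  | zero_mul (a b : A) : ToeplitzRel (α.gen (α.toFibreZero (a * b)))
      (α.gen (α.toFibreZero a) * α.gen (α.toFibreZero b))
  | zero_star (a : A) : ToeplitzRel (α.gen (α.toFibreZero (star a)))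
      (star (α.gen (α.toFibreZero a)))
  | right {s : PosCone Γ} (x : α.Fibre s) (a : A) :
      ToeplitzRel (α.gen (α.rightAct x a)) (α.gen x * α.gen (α.toFibreZero a))
  | inner {s : PosCone Γ} (x y : α.Fibre s) :
      ToeplitzRel (star (α.gen x) * α.gen y) (α.gen (α.toFibreZero (α.fibreInner x y)))
  | left {s : PosCone Γ} (a : A) (x : α.Fibre s) :
      ToeplitzRel (α.gen (α.leftAct a x)) (α.gen (α.toFibreZero a) * α.gen x)
  | mul {s t : PosCone Γ} (x : α.Fibre s) (y : α.Fibre t) :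
      ToeplitzRel (α.gen (α.fibreMul x y)) (α.gen x * α.gen y)
  | one : ToeplitzRel (α.gen (α.toFibreZero 1)) 1

/-- The C⋆-seminorms in which the Toeplitz relations hold. -/
def toeplitzSeminorms : Set (CStarSeminorm α.Free) :=
  {p | ∀ x y, α.ToeplitzRel x y → p (x - y) = 0}

theorem zero_mem_toeplitzSeminorms : CStarSeminorm.zero α.Free ∈ α.toeplitzSeminorms :=
  fun _ _ _ => rfl

variable {α} in
theorem toCompl_eq {p : CStarSeminorm α.Free} (hp : p ∈ α.toeplitzSeminorms) {x y : α.Free}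
    (h : α.ToeplitzRel x y) : p.toCompl x = p.toCompl y := by
  rw [← sub_eq_zero, ← p.toCompl_sub, ← norm_eq_zero, p.norm_toCompl, hp x y h]

variable {α} in
theorem apply_gen_zero_le {p : CStarSeminorm α.Free} (hp : p ∈ α.toeplitzSeminorms) (a : A) :
    p (α.gen (α.toFibreZero a)) ≤ ‖a‖ := by
  let f : A →⋆ₙₐ[ℂ] p.Compl :=
    { toFun := fun a => p.toCompl (α.gen (α.toFibreZero a))
      map_smul' := fun c a => by
        have := toCompl_eq hp (.smul c (α.toFibreZero a))
        rw [p.toCompl_smul] at this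
        exact this
      map_zero' := by
        have := toCompl_eq hp (.smul 0 (α.toFibreZero 0))
        rw [p.toCompl_smul, zero_smul, zero_smul] at this
        exact this
      map_add' := fun a b => by
        have := toCompl_eq hp (.add (α.toFibreZero a) (α.toFibreZero b))
        rw [p.toCompl_add] at this
        exact this
      map_mul' := fun a b => by
        rw [toCompl_eq hp (.zero_mul a b), p.toCompl_mul]
      map_star' := fun a => by
        rw [toCompl_eq hp (.zero_star a), p.toCompl_star] }
  have := NonUnitalStarAlgHom.norm_apply_le f a
  rwa [show f a = p.toCompl (α.gen (α.toFibreZero a)) from rfl, p.norm_toCompl] at this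

variable {α} in
theorem apply_gen_le {p : CStarSeminorm α.Free} (hp : p ∈ α.toeplitzSeminorms) {s : PosCone Γ}
    (x : α.Fibre s) : p (α.gen x) ≤ ‖(x : A)‖ := by
  have h1 : p (α.gen x) ^ 2 ≤ ‖(x : A)‖ ^ 2 := by
    rw [← p.star_mul_self, p.eq_of_sub (hp _ _ (.inner x x))]
    refine (apply_gen_zero_le hp _).trans ?_
    rw [fibreInner, CStarRing.norm_star_mul_self, sq]
  exact le_of_sq_le_sq h1 (norm_nonneg _)

/-- The C⋆-seminorms in which the Toeplitz relations hold are pointwise bounded. -/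
theorem bddAbove_toeplitzSeminorms (x : α.Free) :
    BddAbove (Set.range fun p : α.toeplitzSeminorms => (p : CStarSeminorm α.Free) x) := by
  suffices ∃ M : ℝ, ∀ p ∈ α.toeplitzSeminorms, p x ≤ M by
    obtain ⟨M, hM⟩ := this
    exact ⟨M, by rintro _ ⟨p, rfl⟩; exact hM p.1 p.2⟩
  refine FreeStarAlgebra.induction
    (P := fun x => ∃ M : ℝ, ∀ p ∈ α.toeplitzSeminorms, p x ≤ M) ?_ ?_ ?_ ?_ x
  · intro c
    refine ⟨‖c‖ * ‖(1 : A)‖, fun p hp => ?_⟩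
    rw [Algebra.algebraMap_eq_smul_one, map_smul_eq_mul, ← p.eq_of_sub (hp _ _ .one)]
    exact mul_le_mul_of_nonneg_left (apply_gen_zero_le hp 1) (norm_nonneg c)
  · rintro ⟨⟨s, y⟩, b⟩
    refine ⟨‖(y : A)‖, fun p hp => ?_⟩
    cases b
    · exact apply_gen_le hp y
    · have h : FreeStarAlgebra.letter ((⟨s, y⟩ : Σ s, α.Fibre s), true) = star (α.gen y) :=
        (FreeStarAlgebra.star_letter ((⟨s, y⟩ : Σ s, α.Fibre s), false)).symm
      rw [h, p.map_star]
      exact apply_gen_le hp y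
  · rintro x y ⟨M, hM⟩ ⟨N, hN⟩
    exact ⟨M * N, fun p hp => (p.mul_le x y).trans (mul_le_mul (hM p hp) (hN p hp) (p.nonneg y)
      ((p.nonneg x).trans (hM p hp)))⟩
  · rintro x y ⟨M, hM⟩ ⟨N, hN⟩
    exact ⟨M + N, fun p hp => (map_add_le_add p.toSeminorm x y).trans
      (add_le_add (hM p hp) (hN p hp))⟩

/-- The largest C⋆-seminorm in which the Toeplitz relations hold. -/
def toeplitzSeminorm : CStarSeminorm α.Free :=
  CStarSeminorm.sup α.toeplitzSeminorms ⟨_, α.zero_mem_toeplitzSeminorms⟩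
    α.bddAbove_toeplitzSeminorms

/-- The partial-isometric crossed product `A ×_α Γ⁺`: the Toeplitz algebra of the product system
`X`, that is, the universal C⋆-algebra generated by a Toeplitz representation of `X`, constructed
as the completion of the free `*`-algebra on `X` in the largest C⋆-seminorm in which the Toeplitz
relations hold. -/
def CrossedProduct : Type _ := α.toeplitzSeminorm.Compl

instance : CStarAlgebra α.CrossedProduct := inferInstanceAs (CStarAlgebra α.toeplitzSeminorm.Compl)

/-- The universal Toeplitz representation `i_X` of the product system. -/
def toeplitz {s : PosCone Γ} (x : α.Fibre s) : α.CrossedProduct :=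
  α.toeplitzSeminorm.toCompl (α.gen x)

/-- The canonical map `i_{Γ⁺}` of `Γ⁺` into the crossed product, `i_{Γ⁺}(s) = i_X(s, α_s(1))⋆`. -/
def crossedIso (s : PosCone Γ) : α.CrossedProduct := star (α.toeplitz (α.fibreOne s))

end EndoAction

/-! ### The algebras `B_I` and the translation actions -/

section Interval

variable {Γ : Type*} [AddCommGroup Γ] [LinearOrder Γ] [IsOrderedAddMonoid Γ]

/-- `ℓ^∞(I)`, for an initial segment `I` of `Γ⁺`. -/
abbrev EllInf (I : LowerSet (PosCone Γ)) : Type _ := lp (fun _ : I => ℂ) ∞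

instance (I : LowerSet (PosCone Γ)) : CStarAlgebra (EllInf I) where

/-- The characteristic function `1_t^I` of `I ∩ [t, ∞)`. -/
def charFn (I : LowerSet (PosCone Γ)) (t : PosCone Γ) : EllInf I :=
  ⟨fun x => if t ≤ (x : PosCone Γ) then 1 else 0, memℓp_infty ⟨1, by
    rintro _ ⟨x, rfl⟩
    dsimp only
    split_ifs <;> simp⟩⟩

theorem charFn_apply (I : LowerSet (PosCone Γ)) (t : PosCone Γ) (x : I) :
    (charFn I t : I → ℂ) x = if t ≤ (x : PosCone Γ) then 1 else 0 := rfl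

theorem star_charFn (I : LowerSet (PosCone Γ)) (t : PosCone Γ) :
    star (charFn I t) = charFn I t := by
  ext x
  rw [lp.star_apply, charFn_apply]
  split_ifs <;> simp

theorem charFn_mul (I : LowerSet (PosCone Γ)) (t u : PosCone Γ) :
    charFn I t * charFn I u = charFn I (max t u) := by
  ext x
  rw [lp.infty_coeFn_mul, Pi.mul_apply, charFn_apply, charFn_apply, charFn_apply]
  by_cases h1 : t ≤ (x : PosCone Γ) <;> by_cases h2 : u ≤ (x : PosCone Γ) <;>
    simp [-not_le, max_le_iff, h1, h2]

/-- The linear span of the functions `1_t^I`, `t ∈ I`. -/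
def spanChar (I : LowerSet (PosCone Γ)) : Submodule ℂ (EllInf I) :=
  Submodule.span ℂ {f | ∃ t ∈ I, f = charFn I t}

theorem one_mem_spanChar (I : LowerSet (PosCone Γ)) : (1 : EllInf I) ∈ spanChar I := by
  by_cases h : (0 : PosCone Γ) ∈ I
  · refine Submodule.subset_span ⟨0, h, ?_⟩
    ext x
    rw [charFn_apply, if_pos (show (0 : PosCone Γ) ≤ x from x.1.2)]
    rfl
  · have : (1 : EllInf I) = 0 := by
      ext x
      exact absurd (I.lower x.1.2 x.2) h
    rw [this]
    exact zero_mem _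

theorem mul_mem_spanChar {I : LowerSet (PosCone Γ)} {f g : EllInf I} (hf : f ∈ spanChar I)
    (hg : g ∈ spanChar I) : f * g ∈ spanChar I := by
  induction hf, hg using Submodule.span_induction₂ with
  | mem_mem x y hx hy =>
    obtain ⟨t, ht, rfl⟩ := hx
    obtain ⟨u, hu, rfl⟩ := hy
    refine Submodule.subset_span ⟨max t u, ?_, charFn_mul I t u⟩
    rcases max_choice t u with h | h <;> rw [h] <;> assumption
  | zero_left y hy => rw [zero_mul]; exact zero_mem _
  | zero_right x hx => rw [mul_zero]; exact zero_mem _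
  | add_left x y z _ _ _ h1 h2 => rw [add_mul]; exact add_mem h1 h2
  | add_right x y z _ _ _ h1 h2 => rw [mul_add]; exact add_mem h1 h2
  | smul_left r x y _ _ h => rw [smul_mul_assoc]; exact Submodule.smul_mem _ r h
  | smul_right r x y _ _ h => rw [mul_smul_comm]; exact Submodule.smul_mem _ r h

theorem star_mem_spanChar {I : LowerSet (PosCone Γ)} {f : EllInf I} (hf : f ∈ spanChar I) :
    star f ∈ spanChar I := by
  induction hf using Submodule.span_induction with
  | mem x hx =>
    obtain ⟨t, ht, rfl⟩ := hx
    rw [star_charFn]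
    exact Submodule.subset_span ⟨t, ht, rfl⟩
  | zero => rw [star_zero]; exact zero_mem _
  | add x y _ _ h1 h2 => rw [star_add]; exact add_mem h1 h2
  | smul c x _ h => rw [star_smul]; exact Submodule.smul_mem _ _ h

/-- The C⋆-algebra `B_I`, the closed linear span of the functions `1_t^I`, `t ∈ I`. -/
def BAlg (I : LowerSet (PosCone Γ)) : StarSubalgebra ℂ (EllInf I) where
  carrier := closure (spanChar I : Set (EllInf I))
  mul_mem' hf hg := map_mem_closure₂ continuous_mul hf hg fun _ h _ h' => mul_mem_spanChar h h'
  add_mem' hf hg := map_mem_closure₂ continuous_add hf hg fun _ h _ h' => add_mem h h'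
  algebraMap_mem' c := subset_closure (by
    rw [Algebra.algebraMap_eq_smul_one]
    exact Submodule.smul_mem _ c (one_mem_spanChar I))
  star_mem' hf := map_mem_closure continuous_star hf fun _ h => star_mem_spanChar h

instance (I : LowerSet (PosCone Γ)) : IsClosed (BAlg I : Set (EllInf I)) := isClosed_closure

instance (I : LowerSet (PosCone Γ)) : CStarAlgebra (BAlg I) := StarSubalgebra.cstarAlgebra _

/-- The function `τ_r^I(f)`, given by `τ_r^I(f)(t) = f(t - r)` if `t - r ∈ I`, and `0` otherwise;
for `t ∈ I`, the condition `t - r ∈ I` means that `r ≤ t`. -/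
def shiftFun (I : LowerSet (PosCone Γ)) (r : PosCone Γ) (f : I → ℂ) (t : I) : ℂ :=
  if h : r ≤ (t : PosCone Γ) then
    f ⟨⟨(t : PosCone Γ) - r, sub_nonneg.2 h⟩,
      I.lower (show (⟨(t : PosCone Γ) - r, sub_nonneg.2 h⟩ : PosCone Γ) ≤ t from
        sub_le_self _ r.2) t.2⟩
  else 0

/-- The translation `τ_r^I` on `ℓ^∞(I)`. -/
def shift (I : LowerSet (PosCone Γ)) (r : PosCone Γ) : EllInf I →⋆ₙₐ[ℂ] EllInf I where
  toFun f := ⟨shiftFun I r f, memℓp_infty ⟨‖f‖, by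
    rintro _ ⟨t, rfl⟩
    dsimp only
    unfold shiftFun
    split_ifs
    · exact lp.norm_apply_le_norm ENNReal.top_ne_zero f _
    · rw [norm_zero]; exact norm_nonneg f⟩⟩
  map_smul' c f := by
    ext t
    by_cases h : r ≤ (t : PosCone Γ) <;> simp [shiftFun, h]
  map_zero' := by
    ext t
    by_cases h : r ≤ (t : PosCone Γ) <;> simp [shiftFun, h]
  map_add' f g := by
    ext t
    change shiftFun I r (f + g : EllInf I) t = shiftFun I r f t + shiftFun I r g t
    by_cases h : r ≤ (t : PosCone Γ) <;> simp [shiftFun, h]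
  map_mul' f g := by
    ext t
    by_cases h : r ≤ (t : PosCone Γ) <;> simp [shiftFun, h]
  map_star' f := by
    ext t
    by_cases h : r ≤ (t : PosCone Γ) <;> simp [shiftFun, h]

theorem shift_apply (I : LowerSet (PosCone Γ)) (r : PosCone Γ) (f : EllInf I) (t : I) :
    (shift I r f : I → ℂ) t = shiftFun I r f t := rfl

theorem shift_charFn (I : LowerSet (PosCone Γ)) (r t : PosCone Γ) :
    shift I r (charFn I t) = charFn I (r + t) := by
  ext x
  rw [shift_apply, charFn_apply, shiftFun]
  by_cases h : r ≤ (x : PosCone Γ)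
  · rw [dif_pos h, charFn_apply]
    refine if_congr ?_ rfl rfl
    change (t : Γ) ≤ (x : PosCone Γ) - r ↔ (r : Γ) + t ≤ (x : PosCone Γ)
    rw [le_sub_iff_add_le']
  · rw [dif_neg h, if_neg fun h' => h (le_trans (le_add_of_nonneg_right t.2) h')]

theorem shift_mem_spanChar {I : LowerSet (PosCone Γ)} (r : PosCone Γ) {f : EllInf I}
    (hf : f ∈ spanChar I) : shift I r f ∈ spanChar I := by
  induction hf using Submodule.span_induction with
  | mem x hx =>
    obtain ⟨t, ht, rfl⟩ := hx
    rw [shift_charFn]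
    by_cases h : r + t ∈ I
    · exact Submodule.subset_span ⟨_, h, rfl⟩
    · have : charFn I (r + t) = 0 := by
        ext x
        rw [charFn_apply, if_neg fun h' => h (I.lower h' x.2)]
        rfl
      rw [this]
      exact zero_mem _
  | zero => rw [map_zero]; exact zero_mem _
  | add x y _ _ h1 h2 => rw [map_add]; exact add_mem h1 h2
  | smul c x _ h => rw [map_smul]; exact Submodule.smul_mem _ _ h

theorem shift_mem_BAlg {I : LowerSet (PosCone Γ)} (r : PosCone Γ) {f : EllInf I}
    (hf : f ∈ BAlg I) : shift I r f ∈ BAlg I := by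
  have hc : Continuous (shift I r) := by
    refine AddMonoidHomClass.continuous_of_bound (shift I r) 1 fun f => ?_
    rw [one_mul]
    exact NonUnitalStarAlgHom.norm_apply_le (shift I r) f
  exact map_mem_closure hc hf fun _ h => shift_mem_spanChar r h

/-- The dynamical system `(B_I, Γ⁺, τ^I)`. -/
def tau (I : LowerSet (PosCone Γ)) : EndoAction Γ (BAlg I) where
  endo r :=
    { toFun := fun f => ⟨shift I r f, shift_mem_BAlg r f.2⟩
      map_smul' := fun c f => Subtype.ext (map_smul (shift I r) c (f : EllInf I))
      map_zero' := Subtype.ext (map_zero (shift I r))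
      map_add' := fun f g => Subtype.ext (map_add (shift I r) (f : EllInf I) g)
      map_mul' := fun f g => Subtype.ext (map_mul (shift I r) (f : EllInf I) g)
      map_star' := fun f => Subtype.ext (map_star (shift I r) (f : EllInf I)) }
  endo_zero f := by
    apply Subtype.ext
    ext t
    change shiftFun I 0 (f : EllInf I) t = _
    have h : (0 : PosCone Γ) ≤ (t : PosCone Γ) := t.1.2
    simp [shiftFun, h]
  endo_add r q f := by
    apply Subtype.ext
    ext t
    change shiftFun I (r + q) (f : EllInf I) t = shiftFun I r (shiftFun I q (f : EllInf I)) t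
    unfold shiftFun
    by_cases h1 : r ≤ (t : PosCone Γ)
    · rw [dif_pos h1]
      have key : q ≤ (⟨(t : PosCone Γ) - r, sub_nonneg.2 h1⟩ : PosCone Γ) ↔
          r + q ≤ (t : PosCone Γ) := by
        change (q : Γ) ≤ (t : PosCone Γ) - r ↔ (r : Γ) + q ≤ (t : PosCone Γ)
        rw [le_sub_iff_add_le']
      by_cases h2 : r + q ≤ (t : PosCone Γ)
      · rw [dif_pos h2, dif_pos (key.2 h2)]
        refine congrArg (f : EllInf I) (Subtype.ext (Subtype.ext ?_))
        change ((t : PosCone Γ) : Γ) - ((r : Γ) + q) = (t : PosCone Γ) - (r : Γ) - q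
        rw [sub_sub]
      · rw [dif_neg h2, dif_neg fun h => h2 (key.1 h)]
    · rw [dif_neg h1, dif_neg fun h => h1 (le_trans (le_add_of_nonneg_right q.2) h)]

end Interval

/-! ### Partial-isometric representations and their universal C⋆-algebras -/

/-- `V` is a partial-isometric representation of `Γ⁺` in the C⋆-algebra `D`: every `V_s` is a
partial isometry and `V_s V_t = V_{s+t}`.  For `D = B(H)` this is a partial-isometric
representation on the Hilbert space `H`. -/
structure IsPartialIsometricRep {Γ : Type*} [AddCommGroup Γ] [LinearOrder Γ]
    [IsOrderedAddMonoid Γ] {D : Type*} [NonUnitalCStarAlgebra D] (V : PosCone Γ → D) : Prop where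
  partialIsometry : ∀ s, V s * star (V s) * V s = V s
  mul : ∀ s t, V s * V t = V (s + t)

/-- `(T, V)` is the universal C⋆-algebra generated by a partial-isometric representation of `Γ⁺`
that vanishes off `I`: `V` is such a representation, `T` is the closed `*`-algebra
generated by the `V_s`, and every such representation `W` in a C⋆-algebra `D` is `φ ∘ V` for a unique
`*`-homomorphism `φ : T → D`.  (No units are required or preserved: `W_0` may be any projection.) -/
structure IsUniversalPartialIsometricRep {Γ : Type*} [AddCommGroup Γ] [LinearOrder Γ]
    [IsOrderedAddMonoid Γ] (I : LowerSet (PosCone Γ)) {T : Type*} [NonUnitalCStarAlgebra T]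
    (V : PosCone Γ → T) : Prop where
  isRep : IsPartialIsometricRep V
  eq_zero : ∀ r, r ∉ I → V r = 0
  generates : (NonUnitalStarAlgebra.adjoin ℂ (Set.range V)).topologicalClosure = ⊤
  existsUnique_lift : ∀ (D : Type w) [NonUnitalCStarAlgebra D] (W : PosCone Γ → D),
    IsPartialIsometricRep W → (∀ r, r ∉ I → W r = 0) →
      ∃! φ : T →⋆ₙₐ[ℂ] D, ∀ s, φ (V s) = W s

end

/-! ### Universal properties of the free `*`-algebra and of completions -/

/-! The point is that a representation `W` vanishing off `I` already carries the whole covariant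
structure. Since `W u = W t * W (u - t)` for `t ≤ u`, the range projections `W t * star (W t)`
decrease in `t`, and they vanish off `I`. The algebra `B_I` is universal for such families
(`exists_starAlgHom_BAlg`), which yields `π` with `π(1_t) = W_t W_t⋆`.

The pair `(π, W)` is covariant, `π(b) W_r⋆ = W_r⋆ π(τ_r b)`. On `b = 1_t` this amounts to `W_r⋆ W_r`
commuting with `W_t W_t⋆`, and it does because the product `W_r W_t = W_{r+t}` is again a partial
isometry (`commute_of_mul_partialIsometry`). Hence `x ↦ W_r⋆ π(x)` is a Toeplitz representation of
the product system, and it factors through the crossed product (`IsToeplitzRep.exists_lift`). The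
resulting `φ` takes `i_{Γ⁺}(r)` to `(W_r⋆ W_r W_r⋆)⋆ = W_r`.

Uniqueness is generation: `i_{Γ⁺}(r) i_{Γ⁺}(r)⋆ = i_X(0, 1_r)`, so the `i_{Γ⁺}(r)` produce the image
of `B_I`, and `i_X(r, x) = i_{Γ⁺}(r)⋆ i_X(0, x)` gives the other fibres. Off `I` the fibre is zero
because `τ_r(1) = 1_r = 0`. -/

theorem FreeStarAlgebra.exists_starAlgHom {G U : Type*} [Ring U] [StarRing U] [Algebra ℂ U]
    [StarModule ℂ U] (f : G → U) :
    ∃ ρ : FreeStarAlgebra G →⋆ₐ[ℂ] U, ∀ g, ρ (gen g) = f g := by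
  let h : FreeStarAlgebra G →ₐ[ℂ] U :=
    FreeAlgebra.lift ℂ fun y : G × Bool => if y.2 then star (f y.1) else f y.1
  have hl : ∀ y, h (letter y) = if y.2 then star (f y.1) else f y.1 := fun y =>
    FreeAlgebra.lift_ι_apply (R := ℂ) _ y
  refine ⟨{ h with map_star' := fun x => ?_ },
    fun g => (hl (g, false)).trans (if_neg Bool.false_ne_true)⟩
  change h (star x) = star (h x)
  refine induction (P := fun x => h (star x) = star (h x)) ?_ ?_ ?_ ?_ x
  · intro c
    rw [← algebraMap_star_comm, AlgHom.commutes, AlgHom.commutes, algebraMap_star_comm]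
  · rintro ⟨g, b⟩
    rw [star_letter, hl, hl]
    cases b <;> simp
  · intro x y hx hy
    rw [star_mul, map_mul, map_mul, star_mul, hx, hy]
  · intro x y hx hy
    rw [star_add, map_add, map_add, star_add, hx, hy]

/-- A family of elements of the corner `P D P` extends to the free unital `*`-algebra, with the
unit mapped to `P`. -/
theorem FreeStarAlgebra.exists_nonUnitalStarAlgHom {G D : Type*} [NonUnitalCStarAlgebra D]
    (f : G → D) {P : D} (hP : star P = P) (hPP : P * P = P) (hl : ∀ g, P * f g = f g)
    (hr : ∀ g, f g * P = f g) :
    ∃ ρ : FreeStarAlgebra G →⋆ₙₐ[ℂ] D, (∀ g, ρ (gen g) = f g) ∧ ρ 1 = P := by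
  obtain ⟨ρ, hρ⟩ := exists_starAlgHom fun g => (f g : Unitization ℂ D)
  -- Commutation with `P` is what makes the compression `x ↦ ρ x * P` multiplicative and
  -- `*`-preserving.
  have hcomm : ∀ x, Commute (ρ x) (P : Unitization ℂ D) := by
    refine induction ?_ ?_ ?_ ?_
    · intro c
      rw [AlgHomClass.commutes]
      exact Algebra.commutes c _
    · have hg : ∀ g, Commute (ρ (gen g)) (P : Unitization ℂ D) := fun g => by
        rw [hρ, Commute, SemiconjBy, ← Unitization.inr_mul, ← Unitization.inr_mul, hl, hr]
      rintro ⟨g, b⟩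
      cases b
      · exact hg g
      · have h1 : letter (g, true) = star (gen g) := (star_letter (g, false)).symm
        have h2 := (hg g).star_star
        rwa [← Unitization.inr_star, hP, ← map_star, ← h1] at h2
    · intro x y hx hy
      rw [map_mul]
      exact hx.mul_left hy
    · intro x y hx hy
      rw [map_add]
      exact hx.add_left hy
  -- `D` is an ideal of its unitization, so the compression takes values in `D`.
  obtain ⟨q, hq⟩ : ∃ q : FreeStarAlgebra G → D, ∀ x, (q x : Unitization ℂ D) = ρ x * P :=
    ⟨fun x => (ρ x * P).snd, fun x => Unitization.ext (by simp) (by simp)⟩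
  have hPP' : (P : Unitization ℂ D) * P = P := by rw [← Unitization.inr_mul, hPP]
  have hP' : star (P : Unitization ℂ D) = P := by rw [← Unitization.inr_star, hP]
  have inj {a b : D} (h : (a : Unitization ℂ D) = b) : a = b := Unitization.inr_injective h
  refine ⟨{ toFun := q
            map_smul' := fun c x => inj ?_
            map_zero' := inj ?_
            map_add' := fun x y => inj ?_
            map_mul' := fun x y => inj ?_
            map_star' := fun x => inj ?_ }, fun g => inj ?_, inj ?_⟩
  · rw [MonoidHom.id_apply, Unitization.inr_smul, hq, hq, map_smul, smul_mul_assoc]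
  · rw [hq, map_zero, zero_mul, Unitization.inr_zero]
  · rw [Unitization.inr_add, hq, hq, hq, map_add, add_mul]
  · rw [Unitization.inr_mul, hq, hq, hq, map_mul, mul_assoc (ρ x) P, ← mul_assoc _ (ρ y),
      ← (hcomm y).eq, mul_assoc (ρ y), hPP', mul_assoc]
  · rw [Unitization.inr_star, hq, hq, star_mul, map_star, hP', ← map_star, (hcomm _).eq]
  · refine (hq (gen g)).trans ?_
    rw [hρ, ← Unitization.inr_mul, hr]
  · refine (hq 1).trans ?_
    rw [map_one, one_mul]

namespace CStarSeminorm

variable {F : Type*} [Ring F] [Algebra ℂ F] [StarRing F]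

/-- The pullback of the norm of a C⋆-algebra along a `*`-homomorphism. -/
noncomputable def ofHom {D : Type*} [NonUnitalCStarAlgebra D] (ρ : F →⋆ₙₐ[ℂ] D) :
    CStarSeminorm F where
  toFun x := ‖ρ x‖
  map_zero' := by rw [map_zero, norm_zero]
  add_le' x y := by rw [map_add]; exact norm_add_le _ _
  neg' x := by rw [map_neg, norm_neg]
  smul' c x := by rw [map_smul, norm_smul]
  mul_le' x y := by rw [map_mul]; exact norm_mul_le _ _
  star_mul_self' x := by rw [map_mul, StarHomClass.map_star, CStarRing.norm_star_mul_self, sq]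

theorem ofHom_apply {D : Type*} [NonUnitalCStarAlgebra D] (ρ : F →⋆ₙₐ[ℂ] D) (x : F) :
    ofHom ρ x = ‖ρ x‖ := rfl

theorem le_sup {S : Set (CStarSeminorm F)} (hne : S.Nonempty)
    (hS : ∀ x : F, BddAbove (Set.range fun q : S => (q : CStarSeminorm F) x))
    {q : CStarSeminorm F} (hq : q ∈ S) (x : F) : q x ≤ sup S hne hS x :=
  le_ciSup (hS x) ⟨q, hq⟩

/-- The supremum of C⋆-seminorms vanishes where all of them do. -/
theorem sup_eq_zero {S : Set (CStarSeminorm F)} (hne : S.Nonempty)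
    (hS : ∀ x : F, BddAbove (Set.range fun q : S => (q : CStarSeminorm F) x)) {x : F}
    (h : ∀ q ∈ S, q x = 0) : sup S hne hS x = 0 := by
  have : Nonempty S := hne.to_subtype
  change ⨆ q : S, (q : CStarSeminorm F) x = 0
  rw [iSup_congr fun q : S => h q q.2, ciSup_const]

/-- The bound makes `ρ` a contraction for `p`, so it extends by uniform continuity; the algebraic
identities pass to the completion by density. -/
theorem exists_compl_lift (p : CStarSeminorm F) {D : Type*} [NonUnitalCStarAlgebra D]
    (ρ : F →⋆ₙₐ[ℂ] D) (hρ : ∀ x, ‖ρ x‖ ≤ p x) :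
    ∃ φ : p.Compl →⋆ₙₐ[ℂ] D, ∀ x, φ (p.toCompl x) = ρ x := by
  let f : p.Pre → D := fun x => ρ x
  have hf : UniformContinuous f :=
    (LipschitzWith.of_dist_le_mul (K := 1) fun x y => by
      rw [NNReal.coe_one, one_mul, dist_eq_norm, dist_eq_norm, p.norm_pre]
      exact (congrArg norm (map_sub ρ (x : F) (y : F)).symm).trans_le
        (hρ (x - y : F))).uniformContinuous
  let e : p.Compl → D := UniformSpace.Completion.extension f
  have he : Continuous e := UniformSpace.Completion.continuous_extension
  have hx : ∀ x, e (p.toCompl x) = ρ x := fun x => UniformSpace.Completion.extension_coe hf x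
  have hstar := p.continuous_star_compl
  refine ⟨{ toFun := e, map_smul' := fun c x => ?_, map_zero' := ?_, map_add' := fun x y => ?_,
            map_mul' := fun x y => ?_, map_star' := fun x => ?_ }, hx⟩
  · refine p.denseRange_toCompl.induction_on (p := fun x => e (c • x) = c • e x) x
      (isClosed_eq (he.comp (p.continuous_const_smul_compl c)) (by fun_prop)) fun a => ?_
    rw [← toCompl_smul, hx, hx, map_smul]
  · have := hx (0 : F)
    rwa [map_zero, show p.toCompl 0 = 0 by simpa using p.toCompl_sub 0 0] at this
  · refine p.denseRange_toCompl.induction_on₂ (p := fun x y => e (x + y) = e x + e y)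
      (isClosed_eq (by fun_prop) (by fun_prop)) (fun a b => ?_) x y
    rw [← toCompl_add, hx, hx, hx, map_add]
  · refine p.denseRange_toCompl.induction_on₂ (p := fun x y => e (x * y) = e x * e y)
      (isClosed_eq (by fun_prop) (by fun_prop)) (fun a b => ?_) x y
    rw [← toCompl_mul, hx, hx, hx, map_mul]
  · refine p.denseRange_toCompl.induction_on (p := fun x => e (star x) = star (e x)) x
      (isClosed_eq (by fun_prop) (by fun_prop)) fun a => ?_
    rw [← toCompl_star, hx, hx, StarHomClass.map_star]

end CStarSeminorm

/-! ### The universal property of the crossed product -/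

namespace EndoAction

variable {Γ : Type*} [AddCommGroup Γ] [LinearOrder Γ] [IsOrderedAddMonoid Γ]
  {A : Type*} [CStarAlgebra A] (α : EndoAction Γ A)

/-- A Toeplitz representation of the product system of `α` in a possibly non-unital C⋆-algebra. -/
structure IsToeplitzRep {D : Type*} [NonUnitalCStarAlgebra D] (ψ : ∀ s, α.Fibre s → D) :
    Prop where
  add : ∀ s (x y : α.Fibre s), ψ s (x + y) = ψ s x + ψ s y
  smul : ∀ s (c : ℂ) (x : α.Fibre s), ψ s (c • x) = c • ψ s x
  zero_mul : ∀ a b, ψ 0 (α.toFibreZero (a * b)) = ψ 0 (α.toFibreZero a) * ψ 0 (α.toFibreZero b)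
  zero_star : ∀ a, ψ 0 (α.toFibreZero (star a)) = star (ψ 0 (α.toFibreZero a))
  right : ∀ s (x : α.Fibre s) a, ψ s (α.rightAct x a) = ψ s x * ψ 0 (α.toFibreZero a)
  inner : ∀ s (x y : α.Fibre s), star (ψ s x) * ψ s y = ψ 0 (α.toFibreZero (α.fibreInner x y))
  left : ∀ s a (x : α.Fibre s), ψ s (α.leftAct a x) = ψ 0 (α.toFibreZero a) * ψ s x
  mul : ∀ s t (x : α.Fibre s) (y : α.Fibre t), ψ (s + t) (α.fibreMul x y) = ψ s x * ψ t y

variable {α}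

/-- The norm pulled back from `D` is one of the seminorms in which the Toeplitz relations hold,
hence lies below the largest one. The relation `one` causes no trouble in a non-unital `D`: the unit
is sent to the projection `ψ 0 1`, which is a two-sided unit for every `ψ s x`. -/
theorem IsToeplitzRep.exists_lift {D : Type*} [NonUnitalCStarAlgebra D] {ψ : ∀ s, α.Fibre s → D}
    (hψ : α.IsToeplitzRep ψ) :
    ∃ φ : α.CrossedProduct →⋆ₙₐ[ℂ] D, ∀ s (x : α.Fibre s), φ (α.toeplitz x) = ψ s x := by
  obtain ⟨ρ, hρ, hone⟩ := FreeStarAlgebra.exists_nonUnitalStarAlgHom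
    (f := fun g : Σ s, α.Fibre s => ψ g.1 g.2) (P := ψ 0 (α.toFibreZero 1))
    (by rw [← hψ.zero_star, star_one]) (by rw [← hψ.zero_mul, one_mul])
    (fun ⟨s, x⟩ => by
      rw [← hψ.left]
      exact congrArg (ψ s) (Subtype.ext (mem_fibre.1 x.2)))
    (fun ⟨s, x⟩ => by
      rw [← hψ.right]
      exact congrArg (ψ s) (Subtype.ext (mul_one _)))
  have hg : ∀ {s} (x : α.Fibre s), ρ (α.gen x) = ψ s x := fun {s} x => hρ ⟨s, x⟩
  have hmem : CStarSeminorm.ofHom ρ ∈ α.toeplitzSeminorms := by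
    intro x y h
    rw [CStarSeminorm.ofHom_apply, norm_eq_zero, map_sub, sub_eq_zero]
    cases h with
    | add x y => rw [map_add, hg, hg, hg, hψ.add]
    | smul c x => rw [map_smul, hg, hg, hψ.smul]
    | zero_mul a b => rw [map_mul, hg, hg, hg, hψ.zero_mul]
    | zero_star a => rw [map_star, hg, hg, hψ.zero_star]
    | right x a => rw [map_mul, hg, hg, hg, hψ.right]
    | inner x y => rw [map_mul, map_star, hg, hg, hg, hψ.inner]
    | left a x => rw [map_mul, hg, hg, hg, hψ.left]
    | mul x y => rw [map_mul, hg, hg, hg, hψ.mul]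
    | one => rw [hg, hone]
  obtain ⟨φ, hφ⟩ := α.toeplitzSeminorm.exists_compl_lift ρ
    (CStarSeminorm.le_sup ⟨_, α.zero_mem_toeplitzSeminorms⟩ α.bddAbove_toeplitzSeminorms hmem)
  exact ⟨φ, fun s x => (hφ _).trans (hg x)⟩

theorem toeplitzSeminorm_mem : α.toeplitzSeminorm ∈ α.toeplitzSeminorms := fun _ _ h =>
  CStarSeminorm.sup_eq_zero _ _ fun _ hq => hq _ _ h

theorem isToeplitzRep_toeplitz : α.IsToeplitzRep fun _ x => α.toeplitz x := by
  have h : ∀ {x y}, α.ToeplitzRel x y →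
      α.toeplitzSeminorm.toCompl x = α.toeplitzSeminorm.toCompl y := toCompl_eq toeplitzSeminorm_mem
  refine ⟨fun _ x y => ?_, fun _ c x => ?_, fun a b => ?_, fun a => ?_, fun _ x a => ?_,
    fun _ x y => ?_, fun _ a x => ?_, fun _ _ x y => ?_⟩
  · exact (h (.add x y)).trans (CStarSeminorm.toCompl_add _ _ _)
  · exact (h (.smul c x)).trans (CStarSeminorm.toCompl_smul _ _ _)
  · exact (h (.zero_mul a b)).trans (CStarSeminorm.toCompl_mul _ _ _)
  · exact (h (.zero_star a)).trans (CStarSeminorm.toCompl_star _ _)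
  · exact (h (.right x a)).trans (CStarSeminorm.toCompl_mul _ _ _)
  · refine Eq.trans ?_ (h (.inner x y))
    rw [CStarSeminorm.toCompl_mul, CStarSeminorm.toCompl_star]
    rfl
  · exact (h (.left a x)).trans (CStarSeminorm.toCompl_mul _ _ _)
  · exact (h (.mul x y)).trans (CStarSeminorm.toCompl_mul _ _ _)

theorem norm_toeplitz_le {s : PosCone Γ} (x : α.Fibre s) : ‖α.toeplitz x‖ ≤ ‖(x : A)‖ :=
  (CStarSeminorm.norm_toCompl _ _).trans_le (apply_gen_le toeplitzSeminorm_mem x)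

/-- The restriction of the universal Toeplitz representation to `X_0 = A`. -/
theorem exists_starAlgHom_toeplitz_zero :
    ∃ π : A →⋆ₙₐ[ℂ] α.CrossedProduct, ∀ a, π a = α.toeplitz (α.toFibreZero a) := by
  have h := isToeplitzRep_toeplitz (α := α)
  refine ⟨{ toFun := fun a => α.toeplitz (α.toFibreZero a)
            map_smul' := fun c a => h.smul 0 c (α.toFibreZero a)
            map_zero' := ?_
            map_add' := fun a b => h.add 0 (α.toFibreZero a) (α.toFibreZero b)
            map_mul' := h.zero_mul
            map_star' := h.zero_star }, fun a => rfl⟩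
  have := h.smul 0 0 (α.toFibreZero 0)
  rw [zero_smul, zero_smul] at this
  exact this

/-- As a right `A`-module the fibre is generated by `α_s(1)`, since `x = α_s(1) x`. -/
theorem toeplitz_eq_mul {s : PosCone Γ} (x : α.Fibre s) :
    α.toeplitz x = α.toeplitz (α.fibreOne s) * α.toeplitz (α.toFibreZero x) := by
  rw [← isToeplitzRep_toeplitz.right]
  exact congrArg α.toeplitz (Subtype.ext (mem_fibre.1 x.2).symm)

theorem crossedIso_mul_star (s : PosCone Γ) :
    α.crossedIso s * star (α.crossedIso s) = α.toeplitz (α.toFibreZero (α.endo s 1)) := by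
  rw [crossedIso, star_star, isToeplitzRep_toeplitz.inner]
  refine congrArg α.toeplitz (Subtype.ext ?_)
  change star (α.endo s 1) * α.endo s 1 = α.endo s 1
  rw [← map_star, ← map_mul, star_one, one_mul]

theorem isPartialIsometricRep_crossedIso : IsPartialIsometricRep α.crossedIso where
  partialIsometry s := by
    rw [← star_inj, star_mul, star_mul, star_star, crossedIso_mul_star, crossedIso, star_star]
    exact (toeplitz_eq_mul (α.fibreOne s)).symm
  mul s t := by
    rw [crossedIso, crossedIso, ← star_mul, ← isToeplitzRep_toeplitz.mul, crossedIso]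
    congr 1
    -- Taking adjoints reverses the product, which lands in `X_{t+s}` rather than `X_{s+t}`; the two
    -- elements are compared inside `A`.
    have : ∀ {r q : PosCone Γ} (h : r = q) (x : α.Fibre r) (y : α.Fibre q), (x : A) = y →
        α.toeplitz x = α.toeplitz y := by
      rintro r _ rfl x y h
      rw [Subtype.ext h]
    refine this (add_comm t s) _ _ ?_
    change α.endo s (α.endo t 1) * α.endo s 1 = α.endo (s + t) 1
    rw [← map_mul, mul_one, α.endo_add]

/-- A closed `*`-subalgebra of the crossed product that contains the image of `A` and the
`i_{Γ⁺}(s)` is everything. -/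
theorem eq_top_of_toeplitz_zero_mem (S : NonUnitalStarSubalgebra ℂ α.CrossedProduct)
    (hS : IsClosed (S : Set α.CrossedProduct)) (h0 : ∀ a, α.toeplitz (α.toFibreZero a) ∈ S)
    (hV : ∀ s, α.crossedIso s ∈ S) : S = ⊤ := by
  have hgen : ∀ {s} (x : α.Fibre s), α.toeplitz x ∈ S := fun {s} x => by
    rw [toeplitz_eq_mul]
    refine mul_mem ?_ (h0 _)
    have := star_mem (hV s)
    rwa [crossedIso, star_star] at this
  let p := α.toeplitzSeminorm
  -- `S` is not assumed unital; the unit belongs to it because it is the image of `1 ∈ A`.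
  have hone : p.toCompl 1 ∈ S := by
    rw [← toCompl_eq toeplitzSeminorm_mem .one]
    exact h0 1
  have hF : ∀ x : α.Free, p.toCompl x ∈ S := by
    refine FreeStarAlgebra.induction (P := fun x : α.Free => p.toCompl x ∈ S) ?_ ?_ ?_ ?_
    · intro c
      rw [Algebra.algebraMap_eq_smul_one, CStarSeminorm.toCompl_smul]
      exact S.smul_mem c hone
    · rintro ⟨⟨s, y⟩, b⟩
      cases b
      · exact hgen y
      · have h : FreeStarAlgebra.letter ((⟨s, y⟩ : Σ s, α.Fibre s), true) = star (α.gen y) :=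
          (FreeStarAlgebra.star_letter ((⟨s, y⟩ : Σ s, α.Fibre s), false)).symm
        rw [h, CStarSeminorm.toCompl_star]
        exact S.star_mem' (hgen y)
    · intro x y hx hy
      rw [CStarSeminorm.toCompl_mul]
      exact mul_mem hx hy
    · intro x y hx hy
      rw [CStarSeminorm.toCompl_add]
      exact add_mem hx hy
  refine (eq_top_iff).2 fun x _ => ?_
  exact p.denseRange_toCompl.induction_on (p := fun x => x ∈ (S : Set α.CrossedProduct)) x hS hF

end EndoAction

/-! ### Limits of `*`-homomorphisms and the universal property of `B_I` -/

open Filter Topology in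
/-- A net of `*`-homomorphisms which is eventually constant on a set of generators converges
pointwise on the closed span to a `*`-homomorphism. -/
theorem exists_starAlgHom_of_eventually_eq {ι B D : Type*} [SemilatticeSup ι] [Nonempty ι]
    [NonUnitalCStarAlgebra B] [NonUnitalCStarAlgebra D] (θ : ι → B →⋆ₙₐ[ℂ] D) {X : Set B}
    (hX : ∀ x ∈ X, ∃ d, ∀ᶠ i in atTop, θ i x = d)
    (hd : ∀ b, b ∈ closure (Submodule.span ℂ X : Set B)) :
    ∃ π : B →⋆ₙₐ[ℂ] D, ∀ b d, Tendsto (fun i => θ i b) atTop (𝓝 d) → π b = d := by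
  have hspan : ∀ x ∈ Submodule.span ℂ X, ∃ d, Tendsto (fun i => θ i x) atTop (𝓝 d) := by
    intro x hx
    induction hx using Submodule.span_induction with
    | mem x hx =>
      obtain ⟨d, hd⟩ := hX x hx
      exact ⟨d, tendsto_const_nhds.congr' (hd.mono fun i hi => hi.symm)⟩
    | zero => exact ⟨0, by simp⟩
    | add x y _ _ h1 h2 =>
      obtain ⟨d, h1⟩ := h1
      obtain ⟨e, h2⟩ := h2
      exact ⟨d + e, by simpa using h1.add h2⟩
    | smul c x _ h =>
      obtain ⟨d, h⟩ := h
      exact ⟨c • d, by simpa using h.const_smul c⟩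
  have hall : ∀ b, ∃ d, Tendsto (fun i => θ i b) atTop (𝓝 d) := by
    intro b
    apply cauchySeq_tendsto_of_complete
    rw [Metric.cauchySeq_iff]
    intro ε hε
    obtain ⟨x, hx, hbx⟩ := Metric.mem_closure_iff.1 (hd b) (ε / 3) (by positivity)
    obtain ⟨d, h⟩ := hspan x hx
    obtain ⟨N, hN⟩ := Metric.cauchySeq_iff.1 h.cauchySeq (ε / 3) (by positivity)
    -- All `θ i` are contractive, so convergence on the dense span spreads to its closure by an `ε /
    -- 3` argument.
    have hle : ∀ i, dist (θ i b) (θ i x) ≤ dist b x := fun i => by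
      rw [dist_eq_norm, dist_eq_norm, ← map_sub]
      exact NonUnitalStarAlgHom.norm_apply_le (θ i) _
    refine ⟨N, fun m hm n hn => ?_⟩
    have h1 := dist_triangle4 (θ m b) (θ m x) (θ n x) (θ n b)
    have h2 := hle m
    have h3 := hle n
    rw [dist_comm] at h3
    linarith [hN m hm n hn]
  choose e he using hall
  refine ⟨{ toFun := e, map_smul' := fun c x => ?_, map_zero' := ?_, map_add' := fun x y => ?_,
            map_mul' := fun x y => ?_, map_star' := fun x => ?_ },
    fun b d h => tendsto_nhds_unique (he b) h⟩
  · exact tendsto_nhds_unique (he _) (by simpa using (he x).const_smul c)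
  · exact tendsto_nhds_unique (he _) (by simp)
  · exact tendsto_nhds_unique (he _) (by simpa using (he x).add (he y))
  · exact tendsto_nhds_unique (he _) (by simpa using (he x).mul (he y))
  · exact tendsto_nhds_unique (he _) ((he x).star.congr fun i => (map_star (θ i) x).symm)

section Interval

variable {Γ : Type*} [AddCommGroup Γ] [LinearOrder Γ] [IsOrderedAddMonoid Γ]

/-- Given a decreasing family of projections `p_t` and a finite subset `F` of `I`, there is a
`*`-homomorphism of `ℓ^∞(I)` that maps `1_u^I` to `p_u` for `u ∈ F`. -/
theorem exists_starAlgHom_charFn_finset (I : LowerSet (PosCone Γ)) {D : Type*}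
    [NonUnitalCStarAlgebra D] {p : PosCone Γ → D} (hstar : ∀ t, star (p t) = p t)
    (hmul : ∀ t u, t ≤ u → p t * p u = p u) (F : Finset I) :
    ∃ θ : EllInf I →⋆ₙₐ[ℂ] D, ∀ u ∈ F, θ (charFn I u) = p u := by
  have hmul' : ∀ t u, t ≤ u → p u * p t = p u := fun t u h => by
    rw [← star_inj, star_mul, hstar, hstar, hmul t u h]
  have hcomm : ∀ t u, Commute (p t) (p u) := fun t u => by
    rcases le_total t u with h | h <;> rw [Commute, SemiconjBy, hmul _ _ h, hmul' _ _ h]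
  -- For `F = {t_1 < … < t_n}` the map is `θ f = ∑ f(t_i) (p_{t_i} - p_{t_{i+1}})`, with last term
  -- `f(t_n) p_{t_n}`. The induction also has to record that its values commute with all `p t` and
  -- that it depends only on the restriction of `f` to `F`.
  suffices ∃ θ : EllInf I →⋆ₙₐ[ℂ] D, (∀ u ∈ F, θ (charFn I u) = p u) ∧
      (∀ t f, Commute (p t) (θ f)) ∧
      ∀ f : EllInf I, (∀ x ∈ F, (f : I → ℂ) x = 0) → θ f = 0 from this.imp fun θ h => h.1
  induction F using Finset.induction_on_max with
  | empty => exact ⟨0, by simp, fun t f => Commute.zero_right _, fun f _ => rfl⟩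
  | insert m F hm ih =>
    obtain ⟨θ, h1, h2, h3⟩ := ih
    have hpp := hmul m m le_rfl
    obtain ⟨ev, hev⟩ : ∃ ev : EllInf I →⋆ₙₐ[ℂ] ℂ, ∀ f : EllInf I, ev f = (f : I → ℂ) m :=
      ⟨{ toFun := fun f => (f : I → ℂ) m
         map_smul' := fun _ _ => rfl
         map_zero' := rfl
         map_add' := fun _ _ => rfl
         map_mul' := fun _ _ => rfl
         map_star' := fun _ => rfl }, fun _ => rfl⟩
    -- A new maximum `m` splits off the projection `p m`: the old map is cut down to the complement
    -- of `p m`, and evaluation at `m` acts on `p m`. The two pieces are orthogonal, hence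
    -- multiplicativity.
    refine ⟨{ toFun := fun f => θ f - p m * θ f + ev f • p m,
              map_smul' := fun c f => ?_, map_zero' := ?_, map_add' := fun f g => ?_,
              map_mul' := fun f g => ?_, map_star' := fun f => ?_ }, ?_, ?_, ?_⟩
    · simp [smul_sub, smul_smul, mul_smul_comm]
    · simp
    · simp only [map_add, add_smul, mul_add]
      abel
    · have a1 : θ f * (p m * θ g) = p m * (θ f * θ g) := by
        rw [← mul_assoc, ← (h2 m f).eq, mul_assoc]
      have a2 : p m * θ f * (p m * θ g) = p m * (θ f * θ g) := by
        rw [mul_assoc, a1, ← mul_assoc, hpp]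
      have a3 : θ f * p m = p m * θ f := (h2 m f).eq.symm
      have a4 : p m * θ f * p m = p m * θ f := by rw [mul_assoc, a3, ← mul_assoc, hpp]
      have a5 : p m * (p m * θ g) = p m * θ g := by rw [← mul_assoc, hpp]
      have a6 : p m * θ f * θ g = p m * (θ f * θ g) := mul_assoc _ _ _
      simp only [map_mul, mul_add, add_mul, mul_sub, sub_mul,
        smul_mul_assoc, mul_smul_comm, hpp, a1, a2, a3, a4, a5, a6, sub_self]
      rw [mul_comm (ev f), mul_smul]
      abel_nf
    · simp only [map_star, star_add, star_sub, star_mul, star_smul, hstar]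
      rw [← map_star, (h2 m (star f)).eq]
    · intro u hu
      change θ (charFn I u) - p m * θ (charFn I u) + ev (charFn I u) • p m = p u
      rw [Finset.mem_insert] at hu
      rcases hu with rfl | hu
      -- All points of `F` lie strictly below the new maximum, so its characteristic function
      -- vanishes on `F` and the old map kills it.
      · rw [h3 (charFn I u) fun x hx => by
          rw [charFn_apply, if_neg (not_le.2 (Subtype.coe_lt_coe.2 (hm x hx)))], hev,
          charFn_apply, if_pos le_rfl]
        simp
      · have : (u : PosCone Γ) ≤ m := (hm u hu).le
        rw [h1 u hu, hev, charFn_apply, if_pos this, hmul' _ _ this, one_smul, sub_add_cancel]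
    · intro t f
      exact ((h2 t f).sub_right ((hcomm t m).mul_right (h2 t f))).add_right
        ((hcomm t m).smul_right _)
    · intro f hf
      change θ f - p m * θ f + ev f • p m = 0
      rw [h3 f fun x hx => hf x (Finset.mem_insert_of_mem hx), hev,
        hf m (Finset.mem_insert_self _ _)]
      simp

theorem charFn_eq_zero {I : LowerSet (PosCone Γ)} {t : PosCone Γ} (ht : t ∉ I) :
    charFn I t = 0 := by
  ext x
  rw [charFn_apply, if_neg fun h => ht (I.lower h x.2)]
  rfl

theorem charFn_zero (I : LowerSet (PosCone Γ)) : charFn I 0 = 1 := by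
  ext x
  rw [charFn_apply, if_pos (show (0 : PosCone Γ) ≤ x from x.1.2)]
  rfl

theorem charFn_mem_BAlg (I : LowerSet (PosCone Γ)) (t : PosCone Γ) : charFn I t ∈ BAlg I := by
  by_cases h : t ∈ I
  · exact subset_closure (Submodule.subset_span ⟨t, h, rfl⟩)
  · rw [charFn_eq_zero h]
    exact zero_mem _

theorem mem_closure_span_BAlg (I : LowerSet (PosCone Γ)) (b : BAlg I) :
    b ∈ closure (Submodule.span ℂ
      {f : BAlg I | ∃ t ∈ I, f = ⟨charFn I t, charFn_mem_BAlg I t⟩} : Set (BAlg I)) := by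
  rw [Topology.IsEmbedding.subtypeVal.closure_eq_preimage_closure_image]
  refine closure_mono ?_ b.2
  intro f hf
  suffices ∃ h : f ∈ BAlg I, (⟨f, h⟩ : BAlg I) ∈ Submodule.span ℂ
      {f : BAlg I | ∃ t ∈ I, f = ⟨charFn I t, charFn_mem_BAlg I t⟩} from ⟨⟨f, this.1⟩, this.2, rfl⟩
  refine Submodule.span_induction ?_ ?_ ?_ ?_ hf
  · rintro _ ⟨t, ht, rfl⟩
    exact ⟨charFn_mem_BAlg I t, Submodule.subset_span ⟨t, ht, rfl⟩⟩
  · exact ⟨zero_mem _, zero_mem _⟩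
  · rintro x y _ _ ⟨hx, hx'⟩ ⟨hy, hy'⟩
    exact ⟨add_mem hx hy, add_mem hx' hy'⟩
  · rintro c x _ ⟨hx, hx'⟩
    exact ⟨(BAlg I).smul_mem hx c, Submodule.smul_mem _ c hx'⟩

/-- The universal property of `B_I`: a decreasing family of projections that vanishes off `I`
is the image of the functions `1_t^I`. -/
theorem exists_starAlgHom_BAlg (I : LowerSet (PosCone Γ)) {D : Type*}
    [NonUnitalCStarAlgebra D] {p : PosCone Γ → D} (hstar : ∀ t, star (p t) = p t)
    (hmul : ∀ t u, t ≤ u → p t * p u = p u) (hzero : ∀ t, t ∉ I → p t = 0) :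
    ∃ π : BAlg I →⋆ₙₐ[ℂ] D, ∀ t, π ⟨charFn I t, charFn_mem_BAlg I t⟩ = p t := by
  choose θ hθ using exists_starAlgHom_charFn_finset I hstar hmul
  -- The net is indexed by the finite subsets of `I`; on `1_t` it is constant as soon as `t ∈ F`.
  let θ' : Finset I → BAlg I →⋆ₙₐ[ℂ] D := fun F =>
    (θ F).comp ((BAlg I).subtype : BAlg I →⋆ₙₐ[ℂ] EllInf I)
  have hev : ∀ t ∈ I, ∀ᶠ F in Filter.atTop,
      θ' F ⟨charFn I t, charFn_mem_BAlg I t⟩ = p t := fun t ht => by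
    filter_upwards [Filter.eventually_ge_atTop {(⟨t, ht⟩ : I)}] with F hF
    exact hθ F ⟨t, ht⟩ (hF (Finset.mem_singleton_self _))
  obtain ⟨π, hπ⟩ := exists_starAlgHom_of_eventually_eq θ'
    (fun x hx => by
      obtain ⟨t, ht, rfl⟩ := hx
      exact ⟨p t, hev t ht⟩) (mem_closure_span_BAlg I)
  refine ⟨π, fun t => ?_⟩
  by_cases ht : t ∈ I
  · exact hπ _ _ (tendsto_const_nhds.congr' ((hev t ht).mono fun _ h => h.symm))
  · rw [hzero t ht, show (⟨charFn I t, charFn_mem_BAlg I t⟩ : BAlg I) = 0 from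
      Subtype.ext (charFn_eq_zero ht), map_zero]

/-- A closed linear condition that holds for the functions `1_t^I` holds on `B_I`. -/
theorem BAlg_induction {I : LowerSet (PosCone Γ)} {P : BAlg I → Prop}
    (hc : IsClosed {b | P b}) (hchar : ∀ t, P ⟨charFn I t, charFn_mem_BAlg I t⟩) (h0 : P 0)
    (ha : ∀ a b, P a → P b → P (a + b)) (hs : ∀ (c : ℂ) a, P a → P (c • a)) (b : BAlg I) :
    P b := by
  refine closure_minimal (fun x hx => ?_) hc (mem_closure_span_BAlg I b)
  refine Submodule.span_induction ?_ h0 (fun _ _ _ _ => ha _ _) (fun c _ _ => hs c _) hx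
  rintro _ ⟨t, -, rfl⟩
  exact hchar t

end Interval

/-! ### Partial-isometric representations -/

/-- If the product of two partial isometries is a partial isometry, then the initial projection of
the first commutes with the final projection of the second. -/
theorem commute_of_mul_partialIsometry {D : Type*} [NonUnitalCStarAlgebra D]
    {v w : D} (hv : v * star v * v = v) (hw : w * star w * w = w)
    (hvw : v * w * star (v * w) * (v * w) = v * w) :
    Commute (star v * v) (w * star w) := by
  set e := star v * v with he
  set q := w * star w with hq
  have he' : star e = e := by rw [he, star_mul, star_star]
  have hq' : star q = q := by rw [hq, star_mul, star_star]
  have hee : e * e = e := by rw [he, mul_assoc, ← mul_assoc v, hv]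
  have hqq : q * q = q := by rw [hq, ← mul_assoc, hw]
  -- Sandwiching the relation for `v * w` between `star v` and `star w` shows that `e * q` is
  -- idempotent.
  have heqeq : e * q * e * q = e * q := by
    have := congrArg (fun x => star v * x * star w) hvw
    simp only [star_mul] at this
    simpa only [he, hq, mul_assoc] using this
  have hqeqe : q * e * q * e = q * e := by
    have := congrArg star heqeq
    simpa only [star_mul, he', hq', mul_assoc] using this
  have hqeq : q * e * q * (q * e * q) = q * e * q := by
    calc q * e * q * (q * e * q) = q * e * (q * q) * e * q := by simp only [mul_assoc]
      _ = q * e * q * e * q := by rw [hqq]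
      _ = q * e * q := by rw [hqeqe]
  clear_value e q
  -- By the C⋆-identity it suffices that `(eq - qeq)⋆ (eq - qeq)` vanishes; each of its four terms
  -- equals `± qeq`. Then `eq = qeq` is self-adjoint, so `e` and `q` commute.
  have key : e * q - q * e * q = 0 := by
    rw [← CStarRing.star_mul_self_eq_zero_iff]
    simp only [star_sub, star_mul, he', hq']
    have b1 : q * e * (e * q) = q * e * q := by rw [mul_assoc, ← mul_assoc e, hee, mul_assoc]
    have b2 : q * e * (q * e * q) = q * e * q := by
      rw [← mul_assoc, ← mul_assoc, hqeqe]
    have b3 : q * (e * q) * (e * q) = q * e * q := by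
      rw [mul_assoc, ← mul_assoc (e * q), heqeq, mul_assoc]
    have b4 : q * (e * q) * (q * e * q) = q * e * q := by rw [← mul_assoc q e q, hqeq]
    rw [mul_sub, sub_mul, sub_mul, b1, b2, b3, b4]
    simp
  have h1 : e * q = q * e * q := sub_eq_zero.1 key
  have h2 : q * e = q * e * q := by
    have := congrArg star h1
    simpa only [star_mul, he', hq', mul_assoc] using this
  exact h1.trans h2.symm

namespace IsPartialIsometricRep

variable {Γ : Type*} [AddCommGroup Γ] [LinearOrder Γ] [IsOrderedAddMonoid Γ]
  {D : Type*} [NonUnitalCStarAlgebra D] {W : PosCone Γ → D}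

/-- The product `W s * W t` is `W (s + t)`, itself a partial isometry. -/
theorem commute (hW : IsPartialIsometricRep W) (s t : PosCone Γ) :
    Commute (star (W s) * W s) (W t * star (W t)) :=
  commute_of_mul_partialIsometry (hW.partialIsometry s) (hW.partialIsometry t) (by
    rw [hW.mul, hW.partialIsometry])

/-- An idempotent partial isometry `v` is a projection: all terms of `(v - v⋆v)⋆ (v - v⋆v)` are `±
v⋆v` and cancel, so `v = v⋆v`. -/
theorem star_zero (hW : IsPartialIsometricRep W) : star (W 0) = W 0 := by
  have h1 : W 0 * W 0 = W 0 := by rw [hW.mul, add_zero]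
  have h2 := hW.partialIsometry 0
  have h1' : star (W 0) * star (W 0) = star (W 0) := by rw [← star_mul, h1]
  have key : W 0 - star (W 0) * W 0 = 0 := by
    rw [← CStarRing.star_mul_self_eq_zero_iff]
    simp only [star_sub, star_mul, star_star, mul_sub, sub_mul]
    have b1 : star (W 0) * (star (W 0) * W 0) = star (W 0) * W 0 := by rw [← mul_assoc, h1']
    have b2 : star (W 0) * W 0 * W 0 = star (W 0) * W 0 := by rw [mul_assoc, h1]
    have b3 : star (W 0) * W 0 * (star (W 0) * W 0) = star (W 0) * W 0 := by
      rw [mul_assoc, ← mul_assoc (W 0), h2]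
    rw [b1, b2, b3]
    simp
  have h := sub_eq_zero.1 key
  rw [h, star_mul, star_star]

theorem range_zero (hW : IsPartialIsometricRep W) : W 0 * star (W 0) = W 0 := by
  rw [hW.star_zero, hW.mul, add_zero]

/-- `W u` factors as `W t * W (u - t)`, so its range projection lies under that of `W t`. -/
theorem range_mul (hW : IsPartialIsometricRep W) {t u : PosCone Γ} (h : t ≤ u) :
    W t * star (W t) * (W u * star (W u)) = W u * star (W u) := by
  obtain ⟨v, rfl⟩ : ∃ v : PosCone Γ, u = t + v :=
    ⟨⟨u - t, sub_nonneg.2 h⟩, Subtype.ext (add_sub_cancel _ _).symm⟩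
  rw [← mul_assoc, ← hW.mul t v, ← mul_assoc, hW.partialIsometry]

theorem exists_starAlgHom_BAlg (hW : IsPartialIsometricRep W) (I : LowerSet (PosCone Γ))
    (h0 : ∀ r, r ∉ I → W r = 0) :
    ∃ π : BAlg I →⋆ₙₐ[ℂ] D,
      ∀ t, π ⟨charFn I t, charFn_mem_BAlg I t⟩ = W t * star (W t) :=
  _root_.exists_starAlgHom_BAlg I (fun t => by rw [star_mul, star_star])
    (fun _ _ h => hW.range_mul h) fun t ht => by rw [h0 t ht, zero_mul]

end IsPartialIsometricRep

/-! ### Covariant pairs and Toeplitz representations -/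

theorem NonUnitalStarAlgHom.continuous_of_cstar {B D : Type*} [NonUnitalCStarAlgebra B]
    [NonUnitalCStarAlgebra D] (π : B →⋆ₙₐ[ℂ] D) : Continuous π :=
  AddMonoidHomClass.continuous_of_bound π 1 fun b => by
    rw [one_mul]
    exact NonUnitalStarAlgHom.norm_apply_le π b

/-- An intertwining relation that holds on a set with dense linear span holds everywhere. -/
theorem NonUnitalStarAlgHom.intertwine_of_dense_span {B D : Type*} [NonUnitalCStarAlgebra B]
    [NonUnitalCStarAlgebra D] (π : B →⋆ₙₐ[ℂ] D) (η : B →⋆ₙₐ[ℂ] B) (v : D) {X : Set B}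
    (hX : ∀ b, b ∈ closure (Submodule.span ℂ X : Set B))
    (h : ∀ x ∈ X, π x * v = v * π (η x)) (b : B) : π b * v = v * π (η b) := by
  have c1 := π.continuous_of_cstar
  have c2 := η.continuous_of_cstar
  have hc : IsClosed {b : B | π b * v = v * π (η b)} :=
    isClosed_eq (by fun_prop) (by fun_prop)
  refine closure_minimal (fun x hx => ?_) hc (hX b)
  change π x * v = v * π (η x)
  induction hx using Submodule.span_induction with
  | mem x hx => exact h x hx
  | zero => simp
  | add x y _ _ hx hy => rw [map_add, map_add, map_add, add_mul, mul_add, hx, hy]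
  | smul c x _ hx => rw [map_smul, map_smul, map_smul, smul_mul_assoc, mul_smul_comm, hx]

/-- A covariant pair gives a Toeplitz representation of the product system. -/
theorem EndoAction.isToeplitzRep_of_covariant {Γ : Type*} [AddCommGroup Γ] [LinearOrder Γ]
    [IsOrderedAddMonoid Γ] {A : Type*} [CStarAlgebra A] (α : EndoAction Γ A) {D : Type*}
    [NonUnitalCStarAlgebra D] {W : PosCone Γ → D} (hW : ∀ r t, W r * W t = W (r + t))
    {π : A →⋆ₙₐ[ℂ] D} (h1 : π 1 = star (W 0)) (hr : ∀ r, W r * star (W r) = π (α.endo r 1))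
    (hcov : ∀ r a, π a * star (W r) = star (W r) * π (α.endo r a)) :
    α.IsToeplitzRep fun r x => star (W r) * π (x : A) := by
  -- On `X_0 = A` the representation is therefore just `π`.
  have h0 : ∀ a, star (W 0) * π a = π a := fun a => by rw [← h1, ← map_mul, one_mul]
  refine ⟨fun r x y => ?_, fun r c x => ?_, fun a b => ?_, fun a => ?_, fun r x a => ?_,
    fun r x y => ?_, fun r a x => ?_, fun r t x y => ?_⟩
  · rw [Submodule.coe_add, map_add, mul_add]
  · rw [Submodule.coe_smul, map_smul, mul_smul_comm]
  · simp only [h0]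
    exact map_mul π a b
  · simp only [h0]
    exact map_star π a
  · simp only [h0]
    exact (congrArg _ (map_mul π (x : A) a)).trans (mul_assoc _ _ _).symm
  · simp only [h0]
    change _ = π (star (x : A) * y)
    rw [star_mul, star_star, mul_assoc, ← mul_assoc (W r), hr, ← map_mul,
      EndoAction.mem_fibre.1 y.2, ← map_star, ← map_mul]
  · simp only [h0]
    change star (W r) * π (α.endo r a * (x : A)) = _
    rw [map_mul, ← mul_assoc, ← hcov, mul_assoc]
    rfl
  -- Splitting as `W t * W r` puts `star (W t)` next to `π (α_t(x))`, where covariance turns the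
  -- product into `π x * star (W t)`.
  · change star (W (r + t)) * π (α.endo t x * (y : A)) = _
    rw [add_comm, ← hW, star_mul, map_mul, mul_assoc, ← mul_assoc (star (W t)),
      ← hcov, mul_assoc, mul_assoc]

section Interval

variable {Γ : Type*} [AddCommGroup Γ] [LinearOrder Γ] [IsOrderedAddMonoid Γ]

theorem tau_endo_charFn (I : LowerSet (PosCone Γ)) (r t : PosCone Γ) :
    (tau I).endo r ⟨charFn I t, charFn_mem_BAlg I t⟩ =
      ⟨charFn I (r + t), charFn_mem_BAlg I (r + t)⟩ :=
  Subtype.ext (shift_charFn I r t)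

theorem tau_endo_one (I : LowerSet (PosCone Γ)) (r : PosCone Γ) :
    (tau I).endo r 1 = ⟨charFn I r, charFn_mem_BAlg I r⟩ := by
  have h : (1 : BAlg I) = ⟨charFn I 0, charFn_mem_BAlg I 0⟩ := Subtype.ext (charFn_zero I).symm
  rw [h, tau_endo_charFn]
  simp only [add_zero]

namespace IsPartialIsometricRep

variable {D : Type*} [NonUnitalCStarAlgebra D] {W : PosCone Γ → D}

/-- The covariance relation between a partial-isometric representation and the
`*`-homomorphism of `B_I` given by its range projections. -/
theorem covariant (hW : IsPartialIsometricRep W) {I : LowerSet (PosCone Γ)}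
    {π : BAlg I →⋆ₙₐ[ℂ] D}
    (hπ : ∀ t, π ⟨charFn I t, charFn_mem_BAlg I t⟩ = W t * star (W t)) (r : PosCone Γ)
    (b : BAlg I) : π b * star (W r) = star (W r) * π ((tau I).endo r b) := by
  refine π.intertwine_of_dense_span ((tau I).endo r) _ (mem_closure_span_BAlg I) ?_ b
  rintro _ ⟨t, -, rfl⟩
  have h : star (W r) * W r * star (W r) = star (W r) := by
    have := congrArg star (hW.partialIsometry r)
    simpa only [star_mul, star_star, mul_assoc] using this
  rw [tau_endo_charFn, hπ, hπ, ← hW.mul, star_mul]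
  -- The initial projection of `W r` is inserted for free in front of `star (W r)` and then moved
  -- past the range projection of `W t`.
  calc W t * star (W t) * star (W r)
      = W t * star (W t) * (star (W r) * W r) * star (W r) := by
        rw [mul_assoc (W t * star (W t)), h]
    _ = star (W r) * W r * (W t * star (W t)) * star (W r) := by rw [(hW.commute r t).eq]
    _ = star (W r) * (W r * W t * (star (W t) * star (W r))) := by simp only [mul_assoc]

theorem isToeplitzRep (hW : IsPartialIsometricRep W) {I : LowerSet (PosCone Γ)}
    {π : BAlg I →⋆ₙₐ[ℂ] D}
    (hπ : ∀ t, π ⟨charFn I t, charFn_mem_BAlg I t⟩ = W t * star (W t)) :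
    (tau I).IsToeplitzRep fun r x => star (W r) * π (x : BAlg I) :=
  (tau I).isToeplitzRep_of_covariant hW.mul
    -- The unit is read as `τ_0(1) = 1_0`, whose image is the projection `W 0`.
    (by rw [← (tau I).endo_zero 1, tau_endo_one, hπ, hW.range_zero, hW.star_zero])
    (fun r => by rw [tau_endo_one, hπ]) (hW.covariant hπ)

end IsPartialIsometricRep

/-! ### Vanishing off `I`, generation, and the universal property -/

theorem crossedIso_tau_eq_zero (I : LowerSet (PosCone Γ)) {r : PosCone Γ} (hr : r ∉ I) :
    (tau I).crossedIso r = 0 := by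
  have h : (tau I).endo r 1 = 0 := by
    rw [tau_endo_one]
    exact Subtype.ext (charFn_eq_zero hr)
  have h' : ‖(tau I).toeplitz ((tau I).fibreOne r)‖ ≤ ‖(tau I).endo r 1‖ :=
    EndoAction.norm_toeplitz_le _
  rw [h, norm_zero, norm_le_zero_iff] at h'
  rw [EndoAction.crossedIso, h', star_zero]

/-- The range projection of `i_{Γ⁺}(t)` is the image of `1_t`, and these functions span `B_I`
densely; the image of `B_I` together with the `i_{Γ⁺}(r)` generates everything. -/
theorem generates_crossedIso_tau (I : LowerSet (PosCone Γ)) :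
    (NonUnitalStarAlgebra.adjoin ℂ (Set.range (tau I).crossedIso)).topologicalClosure = ⊤ := by
  set S := (NonUnitalStarAlgebra.adjoin ℂ (Set.range (tau I).crossedIso)).topologicalClosure
    with hS
  have hcl : IsClosed (S : Set (tau I).CrossedProduct) :=
    NonUnitalStarSubalgebra.isClosed_topologicalClosure _
  have hV : ∀ r, (tau I).crossedIso r ∈ S := fun r =>
    NonUnitalStarSubalgebra.le_topologicalClosure _
      (NonUnitalStarAlgebra.subset_adjoin ℂ _ (Set.mem_range_self r))
  refine EndoAction.eq_top_of_toeplitz_zero_mem S hcl ?_ hV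
  obtain ⟨π, hπ⟩ := EndoAction.exists_starAlgHom_toeplitz_zero (α := tau I)
  have hc : Continuous π := π.continuous_of_cstar
  intro a
  rw [← hπ]
  refine BAlg_induction (P := fun b => π b ∈ S) (hcl.preimage hc) (fun t => ?_) ?_
    (fun a b ha hb => ?_) (fun c a ha => ?_) a
  · rw [hπ, ← tau_endo_one, ← EndoAction.crossedIso_mul_star]
    exact mul_mem (hV t) (star_mem (hV t))
  · rw [map_zero]
    exact zero_mem S
  · rw [map_add]
    exact add_mem ha hb
  · rw [map_smul]
    exact S.smul_mem c ha

end Interval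

/-- `*`-homomorphisms of C⋆-algebras that agree on a set of generators are equal. -/
theorem starAlgHom_eq_of_adjoin {T D : Type*} [NonUnitalCStarAlgebra T] [NonUnitalCStarAlgebra D]
    {X : Set T} (hX : (NonUnitalStarAlgebra.adjoin ℂ X).topologicalClosure = ⊤)
    {φ ψ : T →⋆ₙₐ[ℂ] D} (h : ∀ x ∈ X, φ x = ψ x) : φ = ψ := by
  have hle : NonUnitalStarAlgebra.adjoin ℂ X ≤ NonUnitalStarAlgHom.equalizer φ ψ :=
    NonUnitalStarAlgebra.adjoin_le h
  have hle' := NonUnitalStarSubalgebra.topologicalClosure_minimal _ hle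
    (isClosed_eq φ.continuous_of_cstar ψ.continuous_of_cstar)
  ext x
  exact hle' (hX ▸ trivial : x ∈ (NonUnitalStarAlgebra.adjoin ℂ X).topologicalClosure)

theorem proposition5p1 {Γ : Type u} [AddCommGroup Γ] [LinearOrder Γ]
    [IsOrderedAddMonoid Γ] (s : PosCone Γ) (I : LowerSet (PosCone Γ))
    (hI : I = LowerSet.Iic s ∨ I = LowerSet.Iio s) :
    IsUniversalPartialIsometricRep.{w} I (tau I).crossedIso := by
  refine ⟨EndoAction.isPartialIsometricRep_crossedIso, fun r hr => crossedIso_tau_eq_zero I hr,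
    generates_crossedIso_tau I, fun D _ W hW h0 => ?_⟩
  obtain ⟨π, hπ⟩ := hW.exists_starAlgHom_BAlg I h0
  obtain ⟨φ, hφ⟩ := (hW.isToeplitzRep hπ).exists_lift
  -- The generator comes from `τ_r(1) = 1_r`, so its image is `(W_r⋆ (W_r W_r⋆))⋆ = W_r W_r⋆ W_r`.
  have hφV : ∀ r, φ ((tau I).crossedIso r) = W r := fun r => by
    rw [EndoAction.crossedIso, map_star, hφ]
    change star (star (W r) * π ((tau I).endo r 1)) = W r
    rw [tau_endo_one, hπ, star_mul, star_mul, star_star, hW.partialIsometry]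
  refine ⟨φ, hφV, fun φ' h' => starAlgHom_eq_of_adjoin (generates_crossedIso_tau I) ?_⟩
  rintro _ ⟨r, rfl⟩
  rw [hφV, h']
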